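/- A FRACTRAN program is a finite list of positive fractions $f_1,\dots,f_k$. Started at a positive integer $N$, it repeatedly replaces the current integer $N$ by $f_jN$, where $j$ is the least index for which $f_jN$ is an integer; it halts at $N$ when no $f_jN$ is an integer. Let PIGAME be Conway's program \[ \tfrac{365}{46},\tfrac{29}{161},\tfrac{79}{575},\tfrac{679}{451},\tfrac{3159}{413},\tfrac{83}{407},\tfrac{473}{371},\tfrac{638}{355},\tfrac{434}{335},\tfrac{89}{235},\tfrac{17}{209},\tfrac{79}{122},\tfrac{31}{183},\tfrac{41}{115},\tfrac{517}{89},\tfrac{111}{83},\tfrac{305}{79},\tfrac{23}{73},\tfrac{73}{71}, \] \[ \tfrac{61}{67},\tfrac{37}{61},\tfrac{19}{59},\tfrac{89}{57},\tfrac{41}{53},\tfrac{833}{47},\tfrac{53}{43},\tfrac{86}{41},\tfrac{13}{38},\tfrac{23}{37},\tfrac{67}{31},\tfrac{71}{29},\tfrac{83}{19},\tfrac{475}{17},\tfrac{59}{13},\tfrac{41}{291},\tfrac{1}{7},\tfrac{1}{11},\tfrac{1}{1024},\tfrac{1}{97}. \] For even $E\ge 2$ let \[ \pi_E=\frac{2\cdot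 E\,(E-2)^2(E-4)^2\cdots 4^2\,2^2}{(E-1)^2(E-3)^2\cdots 3^2\,1^2}. \] Then: (1) For every integer $n\ge 0$, PIGAME started at $2^n\cdot 89$ halts, and it halts at $2^{d}$, where $d=\lfloor 10^n\pi\rfloor \bmod 10$ is the $n$-th decimal digit of $\pi$ (digit $0$ being the units digit $3$). (2) For every even $E\ge 2$, \[ \pi_E\,\frac{E}{E+1}<\pi<\pi_E ,\qquad\text{and}\qquad |\pi-\pi_E|<\frac{\pi}{E}. \] (3) For every even $E\ge 4$ and every integer $n\ge 0$, the number $10^n\pi_E$ is not an integer. -/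

import Mathlib

/-- One step of the FRACTRAN program `P` (a list of fractions `(a, b)`, standing for `a / b`) on
the register `N`: take the first fraction of the list for which `(a / b) * N` is a whole number,
and replace `N` by that number.  The value is `none` when there is no such fraction. -/
def fractranStep (P : List (ℕ × ℕ)) (N : ℕ) : Option ℕ :=
  (P.find? fun f => decide (f.2 ∣ f.1 * N)).map fun f => f.1 * N / f.2

/-- Started at `N`, the FRACTRAN program `P` reaches `M` in finitely many steps and halts there:
no fraction of `P` applies to `M`. -/
def FractranHaltsAt (P : List (ℕ × ℕ)) (N M : ℕ) : Prop :=
  StateTransition.Reaches (fractranStep P) N M ∧ fractranStep P M = none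

/-- Conway's program PIGAME. -/
def piGame : List (ℕ × ℕ) :=
  [(365, 46), (29, 161), (79, 575), (679, 451), (3159, 413), (83, 407), (473, 371), (638, 355),
   (434, 335), (89, 235), (17, 209), (79, 122), (31, 183), (41, 115), (517, 89), (111, 83),
   (305, 79), (23, 73), (73, 71), (61, 67), (37, 61), (19, 59), (89, 57), (41, 53), (833, 47),
   (53, 43), (86, 41), (13, 38), (23, 37), (67, 31), (71, 29), (83, 19), (475, 17), (59, 13),
   (41, 291), (1, 7), (1, 11), (1, 1024), (1, 97)]

/-- The `n`-th decimal digit of `x ≥ 0`; digit number `0` is the units digit and, for `n ≥ 1`,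
digit number `n` is the `n`-th digit after the decimal point. -/
noncomputable def decimalDigit (x : ℝ) (n : ℕ) : ℕ := ⌊10 ^ n * x⌋₊ % 10

/-- `N_E = 2 * E * (E - 2)^2 * ... * 4^2 * 2^2`, for even `E ≥ 2`. -/
def wallisNum (E : ℕ) : ℕ := 2 * E * ∏ k ∈ Finset.Ico 2 E with Even k, k ^ 2

/-- `D_E = (E - 1)^2 * (E - 3)^2 * ... * 3^2 * 1^2`, for even `E ≥ 2`. -/
def wallisDen (E : ℕ) : ℕ := ∏ k ∈ Finset.Ico 1 E with Odd k, k ^ 2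

/-- The truncated Wallis product `π_E = N_E / D_E`. -/
noncomputable def piApprox (E : ℕ) : ℝ := (wallisNum E : ℝ) / (wallisDen E : ℝ)

/-! PIGAME is a register machine: the exponents of 2, 3, 5, 7, 11 are registers and the remaining
prime is the control state. From `2 ^ n * 89` it builds a huge even `E` (with `E + 4 = 4 * 2 ^ k`,
`10 ^ n ≤ k`) together with `2 * 10 ^ n`. It then multiplies out numerator and denominator of the
truncated Wallis product, divides with remainder and reduces the quotient mod 10, so it halts at the
digit of `π_E` (`fractranHaltsAt_piGame`).

That `π_E` has the same digit as `π` is not automatic: some `p / 10 ^ n` might lie in the interval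
`(π, π_E]`, whose length is below `2 / 2 ^ 10 ^ n`. An effective irrationality bound excludes this
for `n ≥ 7` (`two_div_two_pow_le_abs_sub_pi`); for smaller `n`, known decimals of `π` suffice.

The bound is Hermite's method. The inverse Laplace transform of `1 / (w ^ (N+1) * (w ^ 2 + 1) ^
(N+1))` is a positive number `S` of size about `x ^ (3N+2) / (3N+2)!`, and by partial fractions it
is a combination of 1, `sin x` and `cos x` with polynomial coefficients. If `x` is rational and
within `δ` of `π / 2`, replacing `sin x` by 1 and `cos x` by 0 costs at most `4 ^ (N+1) * δ` and
leaves a rational `t` of controlled denominator. Either `t = 0`, or `|t|` is at least twice the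
upper bound for `S`; both force `δ` to be large.

The inequalities for `π_E` come from the Wallis bounds. Non-integrality of `10 ^ n * π_E` comes from
a Bertrand prime between `E / 2` and `E`, which divides the denominator but not the numerator. -/

/-- The register contents `2 ^ a * 3 ^ b * 5 ^ c * 7 ^ d * 11 ^ e` together with the state `p`. -/
def piState (p a b c d e : ℕ) : ℕ := 2 ^ a * 3 ^ b * 5 ^ c * 7 ^ d * 11 ^ e * p

/-- Some prime shows that the fraction `f` does not apply in state `p`; the flags say which
registers are known to be empty. -/
def blocked (p : ℕ) (za zb zc zd ze : Bool) (f : ℕ × ℕ) : Bool :=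
  [2, 3, 5, 7, 11, 13, 17, 19, 23, 29, 31, 37, 41, 43, 47, 53, 59, 61, 67, 71, 73, 79, 83, 89,
    97].any fun s => f.2 % s == 0 && f.1 % s != 0 && p % s != 0 && (s != 2 || za) &&
      (s != 3 || zb) && (s != 5 || zc) && (s != 7 || zd) && (s != 11 || ze)

theorem not_dvd_of_blocked {p a b c d e : ℕ} {za zb zc zd ze : Bool} {f : ℕ × ℕ}
    (ha : za = true → a = 0) (hb : zb = true → b = 0) (hc : zc = true → c = 0)
    (hd : zd = true → d = 0) (he : ze = true → e = 0)
    (h : blocked p za zb zc zd ze f = true) : ¬ f.2 ∣ f.1 * piState p a b c d e := by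
  obtain ⟨s, hs, h⟩ := List.any_eq_true.1 h
  have hpr : s.Prime := by
    have : ∀ s ∈ [2, 3, 5, 7, 11, 13, 17, 19, 23, 29, 31, 37, 41, 43, 47, 53, 59, 61, 67, 71, 73,
      79, 83, 89, 97], s.Prime := by
      simp only [List.forall_mem_cons]
      norm_num
    exact this s hs
  simp only [Bool.and_eq_true, beq_iff_eq, bne_iff_ne, Bool.or_eq_true] at h
  obtain ⟨⟨⟨⟨⟨⟨⟨h1, h2⟩, h3⟩, h4⟩, h5⟩, h6⟩, h7⟩, h8⟩ := h
  intro hdvd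
  have h9 : s ∣ f.1 * piState p a b c d e := (Nat.dvd_of_mod_eq_zero h1).trans hdvd
  have pw : ∀ r t : ℕ, r.Prime → (s ≠ r ∨ t = 0) → ¬ s ∣ r ^ t := by
    intro r t hr hst hdv
    rcases hst with hst | rfl
    · exact hst ((Nat.prime_dvd_prime_iff_eq hpr hr).1 (hpr.dvd_of_dvd_pow hdv))
    · exact hpr.one_lt.ne' (Nat.dvd_one.1 (by simpa using hdv))
  unfold piState at h9
  simp only [hpr.dvd_mul] at h9
  rcases h9 with h9 | ((((h9 | h9) | h9) | h9) | h9) | h9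
  · exact h2 (Nat.mod_eq_zero_of_dvd h9)
  · exact pw 2 a (by norm_num) (h4.imp_right ha) h9
  · exact pw 3 b (by norm_num) (h5.imp_right hb) h9
  · exact pw 5 c (by norm_num) (h6.imp_right hc) h9
  · exact pw 7 d (by norm_num) (h7.imp_right hd) h9
  · exact pw 11 e (by norm_num) (h8.imp_right he) h9
  · exact h3 (Nat.mod_eq_zero_of_dvd h9)

theorem fractranStep_append {pre suf : List (ℕ × ℕ)} {x y N M : ℕ}
    (hpre : ∀ f ∈ pre, ¬ f.2 ∣ f.1 * N) (hy : 0 < y) (hM : x * N = M * y) :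
    fractranStep (pre ++ (x, y) :: suf) N = some M := by
  have h1 : pre.find? (fun f => decide (f.2 ∣ f.1 * N)) = none := by
    simpa [List.find?_eq_none] using hpre
  have h2 : decide (y ∣ x * N) = true := by simp [hM]
  rw [fractranStep, List.find?_append, h1, Option.none_or,
    List.find?_cons_of_pos (by simpa using h2)]
  simp [hM, Nat.mul_div_cancel _ hy]

/-- `PIGAME` runs from `N` to `M`. -/
abbrev PiReaches (N M : ℕ) : Prop := StateTransition.Reaches (fractranStep piGame) N M

/-- `blocked` only detects a prime missing altogether. The exempted fraction `g` covers the cases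
where a prime is present to too low a power: `575 = 5 ^ 2 * 23` and `1024 = 2 ^ 10`. -/
theorem PiReaches.of_index_of_not_dvd (k : ℕ) (g : ℕ × ℕ) (za zb zc zd ze : Bool)
    {p a b c d e M : ℕ} (hk : k < piGame.length)
    (hbl : (piGame.take k).all (fun f => f == g || blocked p za zb zc zd ze f) = true)
    (hg : ¬ g.2 ∣ g.1 * piState p a b c d e)
    (hM : (piGame[k]).1 * piState p a b c d e = M * (piGame[k]).2)
    (ha : za = true → a = 0 := by simp) (hb : zb = true → b = 0 := by simp)
    (hc : zc = true → c = 0 := by simp) (hd : zd = true → d = 0 := by simp)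
    (he : ze = true → e = 0 := by simp) (hy : 0 < (piGame[k]).2 := by decide) :
    PiReaches (piState p a b c d e) M := by
  refine Relation.ReflTransGen.single ?_
  have hsplit : piGame = piGame.take k ++ (piGame[k].1, piGame[k].2) :: piGame.drop (k + 1) := by
    simp
  rw [Option.mem_def, hsplit]
  refine fractranStep_append (fun f hf => ?_) hy hM
  have := List.all_eq_true.1 hbl f hf
  rw [Bool.or_eq_true, beq_iff_eq] at this
  rcases this with rfl | h
  · exact hg
  · exact not_dvd_of_blocked ha hb hc hd he h

theorem PiReaches.of_index (k : ℕ) (za zb zc zd ze : Bool) {p a b c d e M : ℕ}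
    (hk : k < piGame.length)
    (hbl : (piGame.take k).all (blocked p za zb zc zd ze) = true)
    (hM : (piGame[k]).1 * piState p a b c d e = M * (piGame[k]).2)
    (ha : za = true → a = 0 := by simp) (hb : zb = true → b = 0 := by simp)
    (hc : zc = true → c = 0 := by simp) (hd : zd = true → d = 0 := by simp)
    (he : ze = true → e = 0 := by simp) (hy : 0 < (piGame[k]).2 := by decide) :
    PiReaches (piState p a b c d e) M := by
  refine Relation.ReflTransGen.single ?_
  have hsplit : piGame = piGame.take k ++ (piGame[k].1, piGame[k].2) :: piGame.drop (k + 1) := by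
    simp
  rw [Option.mem_def, hsplit]
  exact fractranStep_append
    (fun f hf => not_dvd_of_blocked ha hb hc hd he (List.all_eq_true.1 hbl f hf)) hy hM

/-! ### Single transitions of PIGAME -/

theorem piGame_89 (a b c d e : ℕ) :
    PiReaches (piState 89 a b c d e) (piState 47 a b c d (e + 1)) :=
  .of_index 14 false false false false false (by decide) (by decide)
    (by simp [piGame, piState]; ring)

theorem piGame_47_c (a b c d e : ℕ) :
    PiReaches (piState 47 a b (c + 1) d e) (piState 89 a b c d e) :=
  .of_index 9 false false false false false (by decide) (by decide)
    (by simp [piGame, piState]; ring)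

theorem piGame_47 (a b d e : ℕ) :
    PiReaches (piState 47 a b 0 d e) (piState 17 a b 0 (d + 2) e) :=
  .of_index 24 false false true false false (by decide) (by decide)
    (by simp [piGame, piState]; ring)

theorem piGame_17 (a b c d e : ℕ) :
    PiReaches (piState 17 a b c d e) (piState 19 a b (c + 2) d e) :=
  .of_index 32 false false false false false (by decide) (by decide)
    (by simp [piGame, piState]; ring)

theorem piGame_19_e (a b c d e : ℕ) :
    PiReaches (piState 19 a b c d (e + 1)) (piState 17 a b c d e) :=
  .of_index 10 false false false false false (by decide) (by decide)
    (by simp [piGame, piState]; ring)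

theorem piGame_19_b (a b c d : ℕ) :
    PiReaches (piState 19 a (b + 1) c d 0) (piState 89 a b c d 0) :=
  .of_index 22 false false false false true (by decide) (by decide)
    (by simp [piGame, piState]; ring)

theorem piGame_19_a (a c d : ℕ) :
    PiReaches (piState 19 (a + 1) 0 c d 0) (piState 13 a 0 c d 0) :=
  .of_index 27 false true false false true (by decide) (by decide)
    (by simp [piGame, piState]; ring)

theorem piGame_19 (c d : ℕ) :
    PiReaches (piState 19 0 0 c d 0) (piState 83 0 0 c d 0) :=
  .of_index 31 true true false false true (by decide) (by decide)
    (by simp [piGame, piState]; ring)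

theorem piGame_13 (a b c d e : ℕ) :
    PiReaches (piState 13 a b c d e) (piState 59 a b c d e) :=
  .of_index 33 false false false false false (by decide) (by decide)
    (by simp [piGame, piState]; ring)

theorem piGame_59_d (a b c d e : ℕ) :
    PiReaches (piState 59 a b c (d + 1) e) (piState 13 a (b + 5) c d e) :=
  .of_index 4 false false false false false (by decide) (by decide)
    (by simp [piGame, piState]; ring)

theorem piGame_59 (a b c e : ℕ) :
    PiReaches (piState 59 a b c 0 e) (piState 19 a b c 0 e) :=
  .of_index 21 false false false true false (by decide) (by decide)
    (by simp [piGame, piState]; ring)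

theorem piGame_83 (a b c d e : ℕ) :
    PiReaches (piState 83 a b c d e) (piState 37 a (b + 1) c d e) :=
  .of_index 15 false false false false false (by decide) (by decide)
    (by simp [piGame, piState]; ring)

theorem piGame_37_e (a b c d e : ℕ) :
    PiReaches (piState 37 a b c d (e + 1)) (piState 83 a b c d e) :=
  .of_index 5 false false false false false (by decide) (by decide)
    (by simp [piGame, piState]; ring)

theorem piGame_37 (a b c d : ℕ) :
    PiReaches (piState 37 a b c d 0) (piState 23 a b c d 0) :=
  .of_index 28 false false false false true (by decide) (by decide)
    (by simp [piGame, piState]; ring)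

theorem piGame_23_a (a b c d e : ℕ) :
    PiReaches (piState 23 (a + 1) b c d e) (piState 73 a b (c + 1) d e) :=
  .of_index 0 false false false false false (by decide) (by decide)
    (by simp [piGame, piState]; ring)

theorem piGame_73 (a b c d e : ℕ) :
    PiReaches (piState 73 a b c d e) (piState 23 a b c d e) :=
  .of_index 17 false false false false false (by decide) (by decide)
    (by simp [piGame, piState]; ring)

theorem piGame_23_d (b c d e : ℕ) :
    PiReaches (piState 23 0 b c (d + 1) e) (piState 29 0 b c d e) :=
  .of_index 1 true false false false false (by decide) (by decide)
    (by simp [piGame, piState]; ring)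

theorem piGame_29 (a b c d e : ℕ) :
    PiReaches (piState 29 a b c d e) (piState 71 a b c d e) :=
  .of_index 30 false false false false false (by decide) (by decide)
    (by simp [piGame, piState]; ring)

theorem piGame_71_c (a b c d e : ℕ) :
    PiReaches (piState 71 a b (c + 1) d e) (piState 29 (a + 1) b c d (e + 1)) :=
  .of_index 7 false false false false false (by decide) (by decide)
    (by simp [piGame, piState]; ring)

theorem piGame_71 (a b d e : ℕ) :
    PiReaches (piState 71 a b 0 d e) (piState 73 a b 0 d e) :=
  .of_index 18 false false true false false (by decide) (by decide)
    (by simp [piGame, piState]; ring)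

theorem piGame_23_c (b c e : ℕ) :
    PiReaches (piState 23 0 b (c + 2) 0 e) (piState 79 0 b c 0 e) :=
  .of_index 2 true false false true false (by decide) (by decide)
    (by simp [piGame, piState]; ring)

theorem piGame_79 (a b c d e : ℕ) :
    PiReaches (piState 79 a b c d e) (piState 61 a b (c + 1) d e) :=
  .of_index 16 false false false false false (by decide) (by decide)
    (by simp [piGame, piState]; ring)

theorem piGame_61_a (a b c d e : ℕ) :
    PiReaches (piState 61 (a + 1) b c d e) (piState 79 a b c d e) :=
  .of_index 11 false false false false false (by decide) (by decide)
    (by simp [piGame, piState]; ring)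

theorem piGame_61_b (b c d e : ℕ) :
    PiReaches (piState 61 0 (b + 1) c d e) (piState 31 0 b c d e) :=
  .of_index 12 true false false false false (by decide) (by decide)
    (by simp [piGame, piState]; ring)

theorem piGame_31 (a b c d e : ℕ) :
    PiReaches (piState 31 a b c d e) (piState 67 a b c d e) :=
  .of_index 29 false false false false false (by decide) (by decide)
    (by simp [piGame, piState]; ring)

theorem piGame_67_c (a b c d e : ℕ) :
    PiReaches (piState 67 a b (c + 1) d e) (piState 31 (a + 1) b c (d + 1) e) :=
  .of_index 8 false false false false false (by decide) (by decide)
    (by simp [piGame, piState]; ring)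

theorem piGame_67 (a b d e : ℕ) :
    PiReaches (piState 67 a b 0 d e) (piState 61 a b 0 d e) :=
  .of_index 19 false false true false false (by decide) (by decide)
    (by simp [piGame, piState]; ring)

theorem piGame_61 (c d e : ℕ) :
    PiReaches (piState 61 0 0 c d e) (piState 37 0 0 c d e) :=
  .of_index 20 true true false false false (by decide) (by decide)
    (by simp [piGame, piState]; ring)

theorem piGame_41_e (a b c d e : ℕ) :
    PiReaches (piState 41 a b c d (e + 1)) (piState 97 a b c (d + 1) e) :=
  .of_index 3 false false false false false (by decide) (by decide)
    (by simp [piGame, piState]; ring)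

theorem piGame_41 (a b c d : ℕ) :
    PiReaches (piState 41 a b c d 0) (piState 43 (a + 1) b c d 0) :=
  .of_index 26 false false false false true (by decide) (by decide)
    (by simp [piGame, piState]; ring)

theorem piGame_43 (a b c d e : ℕ) :
    PiReaches (piState 43 a b c d e) (piState 53 a b c d e) :=
  .of_index 25 false false false false false (by decide) (by decide)
    (by simp [piGame, piState]; ring)

theorem piGame_53_d (a b c d e : ℕ) :
    PiReaches (piState 53 a b c (d + 1) e) (piState 43 a b c d (e + 1)) :=
  .of_index 6 false false false false false (by decide) (by decide)
    (by simp [piGame, piState]; ring)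

theorem piGame_53 (a b c e : ℕ) :
    PiReaches (piState 53 a b c 0 e) (piState 41 a b c 0 e) :=
  .of_index 23 false false false true false (by decide) (by decide)
    (by simp [piGame, piState]; ring)

theorem piGame_97_b (a b c d e : ℕ) :
    PiReaches (piState 97 a (b + 1) c d e) (piState 41 a b c d e) :=
  .of_index 34 false false false false false (by decide) (by decide)
    (by simp [piGame, piState]; ring)

theorem piGame_97_d (a c d e : ℕ) :
    PiReaches (piState 97 a 0 c (d + 1) e) (piState 97 a 0 c d e) :=
  .of_index 35 false true false false false (by decide) (by decide)
    (by simp [piGame, piState]; ring)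

theorem piGame_97_e (a c e : ℕ) :
    PiReaches (piState 97 a 0 c 0 (e + 1)) (piState 97 a 0 c 0 e) :=
  .of_index 36 false true false true false (by decide) (by decide)
    (by simp [piGame, piState]; ring)

theorem piGame_97_a (a c : ℕ) :
    PiReaches (piState 97 (a + 10) 0 c 0 0) (piState 97 a 0 c 0 0) :=
  .of_index 37 false true false true true (by decide) (by decide)
    (by simp [piGame, piState]; ring)

theorem piGame_23_one (b e : ℕ) : PiReaches (piState 23 0 b 1 0 e) (piState 41 0 b 0 0 e) := by
  refine .of_index_of_not_dvd 13 (79, 575) true false false true false (by decide) (by decide) ?_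
    (by simp [piGame, piState]; ring)
  intro h
  have h1 : 5 * 115 ∣ 5 * (79 * (3 ^ b * 11 ^ e * 23)) := by
    convert! h using 1
    simp only [piState]
    ring
  have h2 : 5 ∣ 79 * (3 ^ b * 11 ^ e * 23) :=
    (show 5 ∣ 115 by norm_num).trans (Nat.dvd_of_mul_dvd_mul_left (by norm_num) h1)
  have h5 : Nat.Prime 5 := by norm_num
  simp only [h5.dvd_mul] at h2
  rcases h2 with h2 | (h2 | h2) | h2
  · omega
  · have := h5.dvd_of_dvd_pow h2
    omega
  · have := h5.dvd_of_dvd_pow h2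
    omega
  · omega

theorem not_dvd_two_pow_mul {a k : ℕ} (ha : a < 10) (hk : Odd k) : ¬ 1024 ∣ 1 * (2 ^ a * k) := by
  rw [one_mul]
  intro h
  have h1 : Nat.Coprime (2 ^ 10) k := (Nat.coprime_two_left.2 hk).pow_left 10
  have h2 : 2 ^ 10 ∣ 2 ^ a := h1.dvd_of_dvd_mul_right h
  have := (Nat.pow_dvd_pow_iff_le_right (by norm_num)).1 h2
  omega

theorem piGame_97 {a : ℕ} (ha : a < 10) : PiReaches (piState 97 a 0 0 0 0) (2 ^ a) :=
  .of_index_of_not_dvd 38 (1, 1024) false true true true true (by decide) (by decide)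
    (by simpa [piState] using not_dvd_two_pow_mul ha (by decide : Odd 97))
    (by simp [piGame, piState])

theorem piGame_halt {a : ℕ} (ha : a < 10) : fractranStep piGame (2 ^ a) = none := by
  have hall : piGame.all (fun f => f == (1, 1024) || blocked 1 false true true true true f) =
    true := by decide
  rw [fractranStep, Option.map_eq_none_iff, List.find?_eq_none]
  intro f hf
  have h := List.all_eq_true.1 hall f hf
  rw [Bool.or_eq_true, beq_iff_eq] at h
  rw [decide_eq_true_eq]
  rcases h with rfl | h
  · simpa using not_dvd_two_pow_mul ha odd_one
  · have := not_dvd_of_blocked (a := a) (b := 0) (c := 0) (d := 0) (e := 0)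
      (by simp) (by simp) (by simp) (by simp) (by simp) h
    simpa [piState] using this

/-! ### First phase: building `E` and `2 * 10 ^ n` -/

/-- Building up the power of ten and the large even number. -/
theorem piReaches_89 (a b c d e : ℕ) :
    PiReaches (piState 89 a b c d e) (piState 19 a b 2 (d + 2) (e + c + 1)) := by
  induction c generalizing e with
  | zero => exact (piGame_89 ..).trans ((piGame_47 ..).trans (piGame_17 ..))
  | succ c ih =>
    have := (piGame_89 a b (c + 1) d e).trans ((piGame_47_c ..).trans (ih (e + 1)))
    convert! this using 2
    ring

theorem piReaches_19 (a b c d e : ℕ) :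
    PiReaches (piState 19 a b c d e) (piState 19 a b (c + 2 * e) d 0) := by
  induction e generalizing c with
  | zero => exact .refl
  | succ e ih =>
    have := (piGame_19_e a b c d e).trans ((piGame_17 ..).trans (ih (c + 2)))
    convert! this using 2
    ring

theorem piReaches_19_succ (a b c d : ℕ) :
    PiReaches (piState 19 a (b + 1) c d 0) (piState 19 a b (2 * c + 4) (d + 2) 0) := by
  have := (piGame_19_b a b c d).trans ((piReaches_89 ..).trans (piReaches_19 ..))
  convert! this using 2
  ring

/-- Each unit of register 3 sends `c` to `2 * c + 4`, which doubles `c + 4`, and adds 2 to register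
7. -/
theorem piReaches_19_loop (a b c d k : ℕ) (hc : c + 4 = 4 * 2 ^ k) :
    ∃ c', c' + 4 = 4 * 2 ^ (k + b) ∧
      PiReaches (piState 19 a b c d 0) (piState 19 a 0 c' (d + 2 * b) 0) := by
  induction b generalizing c d k with
  | zero => exact ⟨c, hc, .refl⟩
  | succ b ih =>
    obtain ⟨c', h1, h2⟩ := ih (2 * c + 4) (d + 2) (k + 1) (by rw [pow_succ]; omega)
    refine ⟨c', by rw [h1]; ring, ?_⟩
    have := (piReaches_19_succ a b c d).trans h2
    convert! this using 2
    ring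

theorem piReaches_59 (a b c d : ℕ) :
    PiReaches (piState 59 a b c d 0) (piState 19 a (b + 5 * d) c 0 0) := by
  induction d generalizing b with
  | zero => exact piGame_59 ..
  | succ d ih =>
    have := (piGame_59_d a b c d 0).trans ((piGame_13 ..).trans (ih (b + 5)))
    convert! this using 2
    ring

/-- One unit of register 2 buys a multiplication by ten: every unit of register 7 becomes five units
of register 3, and each of these gives back two units of register 7. -/
theorem piReaches_19_ten (a c k m : ℕ) (hc : c + 4 = 4 * 2 ^ k) :
    ∃ c', c' + 4 = 4 * 2 ^ (k + 10 * m) ∧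
      PiReaches (piState 19 (a + 1) 0 c (2 * m) 0) (piState 19 a 0 c' (2 * (10 * m)) 0) := by
  obtain ⟨c', h1, h2⟩ := piReaches_19_loop a (10 * m) c 0 k hc
  refine ⟨c', h1, ?_⟩
  have := (piReaches_59 a 0 c (2 * m))
  rw [show 0 + 5 * (2 * m) = 10 * m by ring] at this
  rw [zero_add] at h2
  exact (piGame_19_a ..).trans ((piGame_13 ..).trans (this.trans h2))

theorem piReaches_19_pow (a c k i : ℕ) (hc : c + 4 = 4 * 2 ^ k) (hk : 10 ^ i ≤ k) :
    ∃ c' k', c' + 4 = 4 * 2 ^ k' ∧ 10 ^ (i + a) ≤ k' ∧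
      PiReaches (piState 19 a 0 c (2 * 10 ^ i) 0) (piState 19 0 0 c' (2 * 10 ^ (i + a)) 0) := by
  induction a generalizing c k i with
  | zero => exact ⟨c, k, hc, hk, .refl⟩
  | succ a ih =>
    obtain ⟨c₁, h1, h2⟩ := piReaches_19_ten a c k (10 ^ i) hc
    obtain ⟨c', k', h3, h4, h5⟩ := ih c₁ (k + 10 * 10 ^ i) (i + 1) h1 (by rw [pow_succ]; omega)
    rw [show i + 1 + a = i + (a + 1) by ring] at h4 h5
    rw [show 10 * 10 ^ i = 10 ^ (i + 1) by ring] at h2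
    exact ⟨c', k', h3, h4, h2.trans h5⟩

theorem piReaches_83_of_89 (n : ℕ) : ∃ E k, E + 4 = 4 * 2 ^ k ∧ 10 ^ n ≤ k ∧
    PiReaches (piState 89 n 0 0 0 0) (piState 83 0 0 E (2 * 10 ^ n) 0) := by
  obtain ⟨E, k, h1, h2, h3⟩ := piReaches_19_pow n 4 1 0 (by norm_num) (by norm_num)
  rw [zero_add] at h2 h3
  refine ⟨E, k, h1, h2, ?_⟩
  exact (piReaches_89 n 0 0 0 0).trans ((piReaches_19 ..).trans (h3.trans (piGame_19 ..)))

/-! ### Second phase: multiplying out the Wallis product -/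

theorem piReaches_37 (b c d e : ℕ) :
    PiReaches (piState 37 0 b c d e) (piState 23 0 (b + e) c d 0) := by
  induction e generalizing b with
  | zero => exact piGame_37 ..
  | succ e ih =>
    have := (piGame_37_e 0 b c d e).trans ((piGame_83 ..).trans (ih (b + 1)))
    convert! this using 2
    ring

theorem piReaches_23_restore (a b c d e : ℕ) :
    PiReaches (piState 23 a b c d e) (piState 23 0 b (c + a) d e) := by
  induction a generalizing c with
  | zero => exact .refl
  | succ a ih =>
    have := (piGame_23_a a b c d e).trans ((piGame_73 ..).trans (ih (c + 1)))
    convert! this using 2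
    ring

theorem piReaches_71 (a b c d e : ℕ) :
    PiReaches (piState 71 a b c d e) (piState 73 (a + c) b 0 d (e + c)) := by
  induction c generalizing a e with
  | zero => exact piGame_71 ..
  | succ c ih =>
    have := (piGame_71_c a b c d e).trans ((piGame_29 ..).trans (ih (a + 1) (e + 1)))
    convert! this using 2 <;> ring

/-- Multiplication by repeated addition: each unit of register 7 pays for one pass that moves
register 5 to register 2 while adding it to register 11, and then moves it back. -/
theorem piReaches_23_mul (b c d e : ℕ) :
    PiReaches (piState 23 0 b c d e) (piState 23 0 b c 0 (e + c * d)) := by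
  induction d generalizing e with
  | zero => exact .refl
  | succ d ih =>
    have h1 := piReaches_71 0 b c d e
    have h2 := piReaches_23_restore (0 + c) b 0 d (e + c)
    rw [zero_add, zero_add] at h2
    rw [zero_add] at h1
    have := (piGame_23_d b c d e).trans ((piGame_29 ..).trans
      (h1.trans ((piGame_73 ..).trans (h2.trans (ih (e + c))))))
    convert! this using 2
    ring

theorem piReaches_61_restore (a b c d e : ℕ) :
    PiReaches (piState 61 a b c d e) (piState 61 0 b (c + a) d e) := by
  induction a generalizing c with
  | zero => exact .refl
  | succ a ih =>
    have := (piGame_61_a a b c d e).trans ((piGame_79 ..).trans (ih (c + 1)))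
    convert! this using 2
    ring

theorem piReaches_67 (a b c d e : ℕ) :
    PiReaches (piState 67 a b c d e) (piState 61 (a + c) b 0 (d + c) e) := by
  induction c generalizing a d with
  | zero => exact piGame_67 ..
  | succ c ih =>
    have := (piGame_67_c a b c d e).trans ((piGame_31 ..).trans (ih (a + 1) (d + 1)))
    convert! this using 2 <;> ring

theorem piReaches_61_mul (b c d e : ℕ) :
    PiReaches (piState 61 0 b c d e) (piState 61 0 0 c (d + b * c) e) := by
  induction b generalizing d with
  | zero =>
    simp only [zero_mul, add_zero]
    exact .refl
  | succ b ih =>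
    have h1 := piReaches_67 0 b c d e
    have h2 := piReaches_61_restore (0 + c) b 0 (d + c) e
    rw [zero_add, zero_add] at h2
    rw [zero_add] at h1
    have := (piGame_61_b b c d e).trans ((piGame_31 ..).trans (h1.trans (h2.trans (ih (d + c)))))
    convert! this using 2
    ring

/-- One factor of the Wallis product: the numerator and the denominator change places. -/
theorem piReaches_23_factor (b c d : ℕ) :
    PiReaches (piState 23 0 b (c + 2) d 0)
      (piState 23 0 ((c + 2) * d) (c + 1) (b * (c + 1)) 0) := by
  have h1 := piReaches_23_mul b (c + 2) d 0
  have h2 := piReaches_61_mul b (c + 1) 0 ((c + 2) * d)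
  have h3 := piReaches_37 0 (c + 1) (b * (c + 1)) ((c + 2) * d)
  rw [zero_add] at h1 h2 h3
  exact h1.trans ((piGame_23_c ..).trans ((piGame_79 ..).trans
    (h2.trans ((piGame_61 ..).trans h3))))

theorem wallisDen_succ (m : ℕ) :
    wallisDen (2 * m + 4) = (2 * m + 3) ^ 2 * wallisDen (2 * m + 2) := by
  unfold wallisDen
  rw [Finset.prod_filter, Finset.prod_filter, show 2 * m + 4 = (2 * m + 2 + 1) + 1 by ring,
    Finset.prod_Ico_succ_top (by omega), Finset.prod_Ico_succ_top (by omega),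
    if_neg (by simp [parity_simps]), if_pos (by simp [parity_simps])]
  ring

theorem wallisNum_succ (m : ℕ) :
    wallisNum (2 * m + 4) = (2 * m + 4) * (2 * m + 2) * wallisNum (2 * m + 2) := by
  unfold wallisNum
  rw [Finset.prod_filter, Finset.prod_filter, show 2 * m + 4 = (2 * m + 2 + 1) + 1 by ring,
    Finset.prod_Ico_succ_top (by omega), Finset.prod_Ico_succ_top (by omega),
    if_pos (by simp [parity_simps]), if_neg (by simp [parity_simps])]
  ring

theorem wallisDen_two : wallisDen 2 = 1 := by decide

theorem wallisNum_two : wallisNum 2 = 4 := by decide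

theorem wallisDen_pos (E : ℕ) : 0 < wallisDen E :=
  Finset.prod_pos fun k hk => by
    have := (Finset.mem_Ico.1 (Finset.mem_filter.1 hk).1).1
    positivity

/-- `N` omits the leading 2 of `wallisNum`, hence the factor in `2 * N`; the program supplies that 2
by starting with `d = 2 * 10 ^ n`. -/
theorem piReaches_wallis (m b d : ℕ) : ∃ N, 2 * N = d * wallisNum (2 * m + 2) ∧
    PiReaches (piState 23 0 b (2 * m + 2) d 0)
      (piState 41 0 N 0 0 (b * wallisDen (2 * m + 2))) := by
  induction m generalizing b d with
  | zero =>
    refine ⟨2 * d, by rw [mul_zero, zero_add, wallisNum_two]; ring, ?_⟩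
    have h1 := piReaches_23_factor b 0 d
    have h2 := piReaches_23_mul ((0 + 2) * d) 1 (b * (0 + 1)) 0
    have := h1.trans (h2.trans (piGame_23_one ..))
    convert! this using 2
    rw [mul_zero, zero_add, wallisDen_two]
    ring
  | succ m ih =>
    -- Two swaps restore the roles of the registers: with `E = 2 * m + 4`, `b` has gained `(E - 1) ^
    -- 2` and `d` has gained `E * (E - 2)`.
    obtain ⟨N, h1, h2⟩ := ih ((2 * m + 3) * (b * (2 * m + 3))) ((2 * m + 4) * d * (2 * m + 2))
    refine ⟨N, ?_, ?_⟩
    · rw [h1, show 2 * (m + 1) + 2 = 2 * m + 4 by ring, wallisNum_succ]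
      ring
    · have := (piReaches_23_factor b (2 * m + 2) d).trans
        ((piReaches_23_factor _ (2 * m + 1) _).trans h2)
      convert! this using 2
      rw [show 2 * (m + 1) + 2 = 2 * m + 4 by ring, wallisDen_succ]
      ring

/-! ### Third phase: division and reduction mod 10 -/

theorem piReaches_41_sub (a b d e k : ℕ) :
    PiReaches (piState 41 a (b + k) 0 d (e + k)) (piState 41 a b 0 (d + k) e) := by
  induction k generalizing d with
  | zero => exact .refl
  | succ k ih =>
    have := (piGame_41_e a (b + k + 1) 0 d (e + k)).trans ((piGame_97_b ..).trans (ih (d + 1)))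
    convert! this using 2
    ring

theorem piReaches_53 (a b d e : ℕ) :
    PiReaches (piState 53 a b 0 d e) (piState 41 a b 0 0 (e + d)) := by
  induction d generalizing e with
  | zero => exact piGame_53 ..
  | succ d ih =>
    have := (piGame_53_d a b 0 d e).trans ((piGame_43 ..).trans (ih (e + 1)))
    convert! this using 2
    ring

/-- A round subtracts the divisor, moving it from register 11 to register 7, counts one in register
2, and moves the divisor back. -/
theorem piReaches_41_div (a r D q : ℕ) :
    PiReaches (piState 41 a (r + q * D) 0 0 D) (piState 41 (a + q) r 0 0 D) := by
  induction q generalizing a with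
  | zero =>
    simp only [zero_mul, add_zero]
    exact .refl
  | succ q ih =>
    have h1 := piReaches_41_sub a (r + q * D) 0 0 D
    have h2 := piReaches_53 (a + 1) (r + q * D) D 0
    rw [zero_add] at h1 h2
    have := h1.trans ((piGame_41 ..).trans ((piGame_43 ..).trans (h2.trans (ih (a + 1)))))
    convert! this using 2 <;> ring

theorem piReaches_97_clear_d (a d e : ℕ) :
    PiReaches (piState 97 a 0 0 d e) (piState 97 a 0 0 0 e) := by
  induction d with
  | zero => exact .refl
  | succ d ih => exact (piGame_97_d ..).trans ih

theorem piReaches_97_clear_e (a e : ℕ) :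
    PiReaches (piState 97 a 0 0 0 e) (piState 97 a 0 0 0 0) := by
  induction e with
  | zero => exact .refl
  | succ e ih => exact (piGame_97_e ..).trans ih

theorem piReaches_97_mod (r q : ℕ) :
    PiReaches (piState 97 (r + q * 10) 0 0 0 0) (piState 97 r 0 0 0 0) := by
  induction q with
  | zero =>
    simp only [zero_mul, add_zero]
    exact .refl
  | succ q ih =>
    have := (piGame_97_a (r + q * 10) 0).trans ih
    convert! this using 2
    ring

theorem piReaches_41_digit (N D : ℕ) (hD : 0 < D) :
    PiReaches (piState 41 0 N 0 0 D) (2 ^ (N / D % 10)) := by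
  have h1 := piReaches_41_div 0 (N % D) D (N / D)
  have hr := Nat.mod_lt N hD
  -- Since the remainder is less than `D`, register 3 runs out while register 11 is still nonempty;
  -- this leads to state 97 with register 3 empty, where the cleanup starts.
  obtain ⟨e, he⟩ : ∃ e, D = e + 1 + N % D := ⟨D - 1 - N % D, by omega⟩
  have h2 := piReaches_41_sub (N / D) 0 0 (e + 1) (N % D)
  rw [zero_add, ← he] at h2
  rw [zero_add, Nat.mod_add_div'] at h1
  have h3 := piReaches_97_mod (N / D % 10) (N / D / 10)
  rw [Nat.mod_add_div'] at h3
  exact h1.trans (h2.trans ((piGame_41_e ..).trans ((piReaches_97_clear_d ..).trans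
    ((piReaches_97_clear_e ..).trans (h3.trans (piGame_97 (Nat.mod_lt _ (by norm_num))))))))

/-- `PIGAME` computes a digit of a truncated Wallis product with a very large parameter. -/
theorem fractranHaltsAt_piGame (n : ℕ) : ∃ E k, E + 4 = 4 * 2 ^ k ∧ 10 ^ n ≤ k ∧
    FractranHaltsAt piGame (2 ^ n * 89) (2 ^ (10 ^ n * wallisNum E / wallisDen E % 10)) := by
  obtain ⟨E, k, h1, h2, h3⟩ := piReaches_83_of_89 n
  refine ⟨E, k, h1, h2, ?_, piGame_halt (Nat.mod_lt _ (by norm_num))⟩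
  obtain ⟨m, hm⟩ : ∃ m, E = 2 * m + 2 := by
    have hk : k ≠ 0 := by
      have : 0 < 10 ^ n := by positivity
      omega
    obtain ⟨j, rfl⟩ := Nat.exists_eq_succ_of_ne_zero hk
    rw [pow_succ] at h1
    have : 0 < 2 ^ j := by positivity
    exact ⟨4 * 2 ^ j - 3, by omega⟩
  subst hm
  obtain ⟨N, h4, h5⟩ := piReaches_wallis m 1 (2 * 10 ^ n)
  have h6 : N = 10 ^ n * wallisNum (2 * m + 2) := by linarith
  rw [one_mul, h6] at h5
  have h7 : piState 89 n 0 0 0 0 = 2 ^ n * 89 := by simp [piState]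
  rw [← h7]
  exact h3.trans ((piGame_83 ..).trans ((piGame_37 ..).trans (h5.trans
    (piReaches_41_digit _ _ (wallisDen_pos _)))))

/-! ### Wallis bounds for `π_E` -/

theorem piApprox_eq_wallis (m : ℕ) :
    piApprox (2 * m + 2) * (2 * m + 2) = 2 * (2 * m + 3) * Real.Wallis.W (m + 1) := by
  induction m with
  | zero => norm_num [piApprox, wallisNum_two, wallisDen_two, Real.Wallis.W]
  | succ m ih =>
    have h1 : piApprox (2 * (m + 1) + 2) =
        piApprox (2 * m + 2) * ((2 * m + 4) * (2 * m + 2) / (2 * m + 3) ^ 2) := by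
      have h2 : (wallisDen (2 * m + 2) : ℝ) ≠ 0 := by exact_mod_cast (wallisDen_pos _).ne'
      rw [show 2 * (m + 1) + 2 = 2 * m + 4 by ring]
      unfold piApprox
      rw [wallisNum_succ, wallisDen_succ]
      push_cast
      field_simp
    rw [Real.Wallis.W_succ, h1]
    push_cast
    have h3 : piApprox (2 * m + 2) * ((2 * m + 4) * (2 * m + 2) / (2 * m + 3) ^ 2) *
        (2 * (m + 1) + 2) = piApprox (2 * m + 2) * (2 * m + 2) *
          ((2 * m + 4) / (2 * m + 3) ^ 2 * (2 * (m + 1) + 2)) := by ring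
    rw [h3, ih]
    field_simp
    ring

/-- Strictness comes from the next partial product, which is larger and still at most `π / 2`. -/
theorem wallis_lt (k : ℕ) : Real.Wallis.W k < Real.pi / 2 := by
  refine lt_of_lt_of_le ?_ (Real.Wallis.W_le (k + 1))
  rw [Real.Wallis.W_succ]
  refine lt_mul_of_one_lt_right (Real.Wallis.W_pos k) ?_
  rw [div_mul_div_comm, one_lt_div (by positivity)]
  nlinarith

theorem exists_eq_two_mul_add_two {E : ℕ} (hE : Even E) (h2 : 2 ≤ E) : ∃ m, E = 2 * m + 2 := by
  obtain ⟨r, rfl⟩ := hE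
  exact ⟨r - 1, by omega⟩

theorem piApprox_mul_lt_pi {E : ℕ} (hE : Even E) (h2 : 2 ≤ E) :
    piApprox E * ((E : ℝ) / ((E : ℝ) + 1)) < Real.pi := by
  obtain ⟨m, rfl⟩ := exists_eq_two_mul_add_two hE h2
  have h := piApprox_eq_wallis m
  have hW := wallis_lt (m + 1)
  push_cast
  rw [mul_div_assoc', h, div_lt_iff₀ (by positivity)]
  nlinarith [Real.pi_pos]

theorem pi_lt_piApprox {E : ℕ} (hE : Even E) (h2 : 2 ≤ E) : Real.pi < piApprox E := by
  obtain ⟨m, rfl⟩ := exists_eq_two_mul_add_two hE h2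
  have h := piApprox_eq_wallis m
  have hW := Real.Wallis.le_W (m + 1)
  rw [div_mul_eq_mul_div, div_le_iff₀ (by positivity)] at hW
  push_cast at hW
  have hpi := Real.pi_pos
  have hm : (0 : ℝ) ≤ m := m.cast_nonneg
  have h3 : Real.pi * (2 * m + 2) < piApprox (2 * m + 2) * (2 * m + 2) := by
    rw [h]
    -- With `E = 2 * m + 2` the claim reduces to `E * (E + 2) < (E + 1) ^ 2`.
    refine lt_of_mul_lt_mul_right ?_ (show (0 : ℝ) ≤ 2 * m + 4 by positivity)
    nlinarith
  exact lt_of_mul_lt_mul_right h3 (by positivity)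

theorem piApprox_sub_pi_lt {E : ℕ} (hE : Even E) (h2 : 2 ≤ E) :
    piApprox E - Real.pi < Real.pi / E := by
  have h := piApprox_mul_lt_pi hE h2
  have hE0 : (0 : ℝ) < E := by positivity
  rw [mul_div_assoc', div_lt_iff₀ (by positivity)] at h
  rw [lt_div_iff₀ hE0]
  linarith

theorem abs_pi_sub_piApprox_lt {E : ℕ} (hE : Even E) (h2 : 2 ≤ E) :
    |Real.pi - piApprox E| < Real.pi / E := by
  rw [abs_sub_comm, abs_of_pos (sub_pos.2 (pi_lt_piApprox hE h2))]
  exact piApprox_sub_pi_lt hE h2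

/-! ### Non-terminating decimals of `π_E` -/

/-- An even multiple of an odd prime `p` is at least `2 * p`, hence exceeds every factor of the
numerator. -/
theorem not_dvd_wallisNum {E p : ℕ} (hp : p.Prime) (h2 : 2 < p) (h1 : p < E) (hE : Even E)
    (hEp : E < 2 * p) : ¬ p ∣ wallisNum E := by
  unfold wallisNum
  rw [hp.dvd_mul, hp.dvd_mul, hp.prime.dvd_finsetProd_iff]
  rintro ((h | ⟨t, rfl⟩) | ⟨k, hk, h⟩)
  · exact absurd (Nat.le_of_dvd (by norm_num) h) (by omega)
  · have : 1 < t := by by_contra! h'; interval_cases t <;> omega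
    nlinarith
  · obtain ⟨h3, h4⟩ := Finset.mem_filter.1 hk
    obtain ⟨h5, h6⟩ := Finset.mem_Ico.1 h3
    obtain ⟨t, rfl⟩ := hp.dvd_of_dvd_pow h
    have h7 : t ≠ 0 := by rintro rfl; omega
    have h8 : t ≠ 1 := by
      rintro rfl
      rw [mul_one] at h4
      have := hp.eq_two_or_odd'
      rcases this with rfl | h9
      · omega
      · exact (Nat.not_even_iff_odd.2 h9) h4
    have : 2 ≤ t := by omega
    nlinarith

theorem dvd_wallisDen {E p : ℕ} (hp : Odd p) (h1 : p < E) : p ∣ wallisDen E :=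
  (Dvd.intro_left _ (pow_succ p 1).symm).trans
    (Finset.dvd_prod_of_mem (fun k => k ^ 2) (Finset.mem_filter.2
      ⟨Finset.mem_Ico.2 ⟨hp.pos, h1⟩, hp⟩))

theorem not_wallisDen_dvd {E : ℕ} (hE : Even E) (h4 : 4 ≤ E) (n : ℕ) :
    ¬ wallisDen E ∣ 10 ^ n * wallisNum E := by
  have key : ∀ p : ℕ, p.Prime → p ≠ 2 → p ≠ 5 → p < E → E < 2 * p →
      ¬ wallisDen E ∣ 10 ^ n * wallisNum E := by
    intro p hp hp2 hp5 h1 h2 h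
    have h3 := (dvd_wallisDen (hp.odd_of_ne_two hp2) h1).trans h
    rcases hp.dvd_mul.1 h3 with h3 | h3
    · have h4 : p ∣ 2 * 5 := hp.dvd_of_dvd_pow h3
      rcases hp.dvd_mul.1 h4 with h4 | h4
      · exact hp2 ((Nat.prime_dvd_prime_iff_eq hp Nat.prime_two).1 h4)
      · exact hp5 ((Nat.prime_dvd_prime_iff_eq hp Nat.prime_five).1 h4)
    · exact not_dvd_wallisNum hp (lt_of_le_of_ne hp.two_le hp2.symm) h1 hE h2 h3
  -- For `E = 6` and `E = 8` Bertrand's prime could be 5, which divides 10. For 6 the power `3 ^ 2`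
  -- is used instead, for 8 the prime 7.
  rcases eq_or_ne E 6 with rfl | h6
  · intro h
    have h3 : 3 ^ 2 ∣ 10 ^ n * 768 := by
      refine Dvd.dvd.trans ?_ h
      decide
    have h5 : 3 ^ 2 ∣ 768 := (Nat.Coprime.pow 2 n (by norm_num)).dvd_of_dvd_mul_left h3
    omega
  rcases eq_or_ne E 8 with rfl | h8
  · exact key 7 (by norm_num) (by norm_num) (by norm_num) (by norm_num) (by norm_num)
  obtain ⟨r, hr⟩ := hE
  obtain ⟨p, hp, h1, h2⟩ := Nat.exists_prime_lt_and_le_two_mul r (by omega)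
  have hp2 : p ≠ 2 := by omega
  have hodd := hp.odd_of_ne_two hp2
  have hpE : p ≠ E := by
    rintro rfl
    exact (Nat.not_even_iff_odd.2 hodd) ⟨r, hr⟩
  exact key p hp hp2 (by omega) (by omega) (by omega)

theorem not_exists_int_piApprox {E : ℕ} (hE : Even E) (h4 : 4 ≤ E) (n : ℕ) :
    ¬ ∃ z : ℤ, (10 : ℝ) ^ n * piApprox E = (z : ℝ) := by
  rintro ⟨z, hz⟩
  have hD : (wallisDen E : ℝ) ≠ 0 := by exact_mod_cast (wallisDen_pos _).ne'
  unfold piApprox at hz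
  rw [mul_div_assoc', div_eq_iff hD] at hz
  have h1 : (10 : ℤ) ^ n * wallisNum E = z * wallisDen E := by exact_mod_cast hz
  refine not_wallisDen_dvd hE h4 n ?_
  rw [← Int.natCast_dvd_natCast]
  push_cast
  exact Dvd.intro_left z h1.symm

/-! ### Hermite's series and their recurrences -/

open Nat in
/-- The power series whose Laplace transform is `1 / (w ^ a * (w ^ 2 + 1) ^ b)`, where
`k = a + 2 * b - 1`. -/
noncomputable def hermiteSeries (x : ℝ) (k b : ℕ) : ℝ :=
  ∑' j : ℕ, (-1) ^ j * (multichoose b j * x ^ (k + 2 * j) / (k + 2 * j)!)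

theorem mul_multichoose_succ (b j : ℕ) :
    b * Nat.multichoose (b + 1) j = (b + j) * Nat.multichoose b j := by
  cases b with
  | zero =>
    cases j with
    | zero => simp
    | succ j => simp [Nat.multichoose_zero_succ]
  | succ c =>
    rw [Nat.multichoose_eq, Nat.multichoose_eq, show c + 1 + 1 + j - 1 = c + j + 1 by omega,
      show c + 1 + j - 1 = c + j by omega]
    have := Nat.choose_mul_succ_eq (c + j) j
    rw [show c + j + 1 - j = c + 1 by omega] at this
    linarith

theorem succ_mul_multichoose (c j : ℕ) :
    (j + 1) * Nat.multichoose (c + 1) (j + 1) = (c + 1 + j) * Nat.multichoose (c + 1) j := by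
  rw [Nat.multichoose_eq, Nat.multichoose_eq, show c + 1 + (j + 1) - 1 = c + j + 1 by omega,
    show c + 1 + j - 1 = c + j by omega]
  have := Nat.add_one_mul_choose_eq (c + j) j
  linarith

theorem multichoose_le (b j : ℕ) : Nat.multichoose b j ≤ 2 ^ (b + j) := by
  rw [Nat.multichoose_eq]
  exact (Nat.choose_le_two_pow _ _).trans (Nat.pow_le_pow_right (by norm_num) (by omega))

open Nat in
theorem summable_hermiteSeries (x : ℝ) (k b : ℕ) :
    Summable fun j : ℕ => (-1 : ℝ) ^ j * (multichoose b j * x ^ (k + 2 * j) / (k + 2 * j)!) := by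
  have h1 := ((Real.summable_pow_div_factorial (2 * |x|)).comp_injective
    (i := fun j : ℕ => k + 2 * j) (fun i j h => by simp at h; omega)).mul_left (2 ^ b)
  refine Summable.of_norm_bounded h1 fun j => ?_
  have h2 : (multichoose b j : ℝ) ≤ 2 ^ (b + (k + 2 * j)) := by
    calc (multichoose b j : ℝ) ≤ ((2 ^ (b + j) : ℕ) : ℝ) := by exact_mod_cast multichoose_le b j
      _ = 2 ^ (b + j) := by push_cast; rfl
      _ ≤ _ := pow_le_pow_right₀ (by norm_num) (by omega)
  simp only [Function.comp, norm_mul, norm_pow, norm_neg, norm_one, one_pow, one_mul, norm_div,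
    Real.norm_eq_abs, Nat.abs_cast]
  rw [mul_pow, mul_div_assoc', ← mul_assoc, ← pow_add]
  gcongr

open Nat in
theorem hermiteSeries_zero (x : ℝ) (k : ℕ) : hermiteSeries x k 0 = x ^ k / k ! := by
  unfold hermiteSeries
  rw [tsum_eq_single 0]
  · simp
  · intro j hj
    obtain ⟨i, rfl⟩ := Nat.exists_eq_succ_of_ne_zero hj
    simp [multichoose_zero_succ]

theorem hermiteSeries_one_one (x : ℝ) : hermiteSeries x 1 1 = Real.sin x := by
  rw [← (Real.hasSum_sin x).tsum_eq]
  refine tsum_congr fun j => ?_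
  rw [Nat.multichoose_one, add_comm 1]
  ring

theorem hermiteSeries_zero_one (x : ℝ) : hermiteSeries x 0 1 = Real.cos x := by
  rw [← (Real.hasSum_cos x).tsum_eq]
  refine tsum_congr fun j => ?_
  rw [Nat.multichoose_one, zero_add]
  ring

/-- On transforms this is the partial fraction step `1 / (w ^ 2 + 1) = 1 - w ^ 2 / (w ^ 2 + 1)`; on
coefficients it is Pascal's rule. -/
theorem hermiteSeries_add_two (x : ℝ) (k b : ℕ) :
    hermiteSeries x (k + 2) (b + 1) = hermiteSeries x k b - hermiteSeries x k (b + 1) := by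
  have h1 := summable_hermiteSeries x k b
  have h2 := summable_hermiteSeries x k (b + 1)
  unfold hermiteSeries
  rw [h1.tsum_eq_zero_add, h2.tsum_eq_zero_add, Nat.multichoose_zero_right,
    Nat.multichoose_zero_right, add_sub_add_left_eq_sub,
    ← ((summable_nat_add_iff 1).2 h1).tsum_sub ((summable_nat_add_iff 1).2 h2)]
  refine tsum_congr fun j => ?_
  rw [Nat.multichoose_succ_succ, show k + 2 + 2 * j = k + 2 * (j + 1) by ring]
  push_cast
  ring

/-- Multiplication by `x` is `-d/dw` on transforms, here applied to `1 / (w ^ 2 + 1) ^ (c + 1)`. -/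
theorem hermiteSeries_mul (x : ℝ) (c : ℕ) :
    (2 * c + 2) * hermiteSeries x (2 * c + 2) (c + 2) =
      x * hermiteSeries x (2 * c + 1) (c + 1) := by
  unfold hermiteSeries
  rw [← tsum_mul_left, ← tsum_mul_left]
  refine tsum_congr fun j => ?_
  have h : ((c : ℝ) + 1) * Nat.multichoose (c + 2) j = (c + 1 + j) * Nat.multichoose (c + 1) j := by
    exact_mod_cast mul_multichoose_succ (c + 1) j
  rw [show 2 * c + 2 + 2 * j = (2 * c + 1 + 2 * j) + 1 by ring, Nat.factorial_succ]
  have h3 : (Nat.multichoose (c + 2) j : ℝ) = (c + 1 + j) * Nat.multichoose (c + 1) j / (c + 1) := by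
    rw [← h]; field_simp
  rw [h3]
  push_cast
  field_simp
  ring

/-- The same rule applied to `w / (w ^ 2 + 1) ^ (c + 1)`. -/
theorem hermiteSeries_odd (x : ℝ) (c : ℕ) :
    (2 * c + 2) * hermiteSeries x (2 * c + 1) (c + 2) =
      hermiteSeries x (2 * c + 1) (c + 1) + x * hermiteSeries x (2 * c) (c + 1) := by
  have h1 := summable_hermiteSeries x (2 * c + 1) (c + 1)
  have h2 := summable_hermiteSeries x (2 * c) (c + 1)
  unfold hermiteSeries
  rw [← tsum_mul_left, ← tsum_mul_left, ← h1.tsum_add (h2.mul_left x)]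
  refine tsum_congr fun j => ?_
  have h : ((c : ℝ) + 1) * Nat.multichoose (c + 2) j = (c + 1 + j) * Nat.multichoose (c + 1) j := by
    exact_mod_cast mul_multichoose_succ (c + 1) j
  rw [show 2 * c + 1 + 2 * j = (2 * c + 2 * j) + 1 by ring, Nat.factorial_succ]
  have h3 : (Nat.multichoose (c + 2) j : ℝ) = (c + 1 + j) * Nat.multichoose (c + 1) j / (c + 1) := by
    rw [← h]; field_simp
  rw [h3]
  push_cast
  field_simp
  ring

/-- For `x ≤ 2` each term is at most half the previous one in absolute value, so the alternating sum
lies between its first two partial sums. -/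
theorem hermiteSeries_bounds {x : ℝ} (h0 : 0 < x) (hx : x ≤ 2) (N : ℕ) :
    x ^ (3 * N + 2) / (3 * N + 2).factorial / 2 ≤ hermiteSeries x (3 * N + 2) (N + 1) ∧
      hermiteSeries x (3 * N + 2) (N + 1) ≤ x ^ (3 * N + 2) / (3 * N + 2).factorial := by
  set f : ℕ → ℝ := fun j => Nat.multichoose (N + 1) j * x ^ (3 * N + 2 + 2 * j) /
    (3 * N + 2 + 2 * j).factorial with hf
  have hpos : ∀ j, 0 ≤ f j := fun j => by positivity
  have hhalf : ∀ j, f (j + 1) ≤ f j / 2 := by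
    intro j
    have h : ((j : ℝ) + 1) * Nat.multichoose (N + 1) (j + 1) =
        (N + 1 + j) * Nat.multichoose (N + 1) j := by
      exact_mod_cast succ_mul_multichoose N j
    have h3 : (Nat.multichoose (N + 1) (j + 1) : ℝ) =
        (N + 1 + j) * Nat.multichoose (N + 1) j / (j + 1) := by
      rw [← h]; field_simp
    have h4 : f (j + 1) = f j * ((N + 1 + j) * x ^ 2 /
        ((j + 1) * ((3 * N + 2 * j + 4) * (3 * N + 2 * j + 3)))) := by
      simp only [hf]
      rw [show 3 * N + 2 + 2 * (j + 1) = (3 * N + 2 + 2 * j) + 1 + 1 by ring, Nat.factorial_succ,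
        Nat.factorial_succ, h3]
      push_cast
      field_simp
      ring
    rw [h4, div_eq_mul_one_div (f j) 2]
    refine mul_le_mul_of_nonneg_left ?_ (hpos j)
    rw [div_le_div_iff₀ (by positivity) (by norm_num), one_mul]
    have hx2 : x ^ 2 ≤ 4 := by nlinarith
    have hN : (0 : ℝ) ≤ N := N.cast_nonneg
    have hj : (0 : ℝ) ≤ j := j.cast_nonneg
    calc (N + 1 + j : ℝ) * x ^ 2 * 2 ≤ (N + 1 + j) * 4 * 2 := by gcongr
      _ = 1 * (4 * (2 * N + 2 * j + 2)) := by ring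
      _ ≤ (j + 1) * ((3 * N + 2 * j + 4) * (3 * N + 2 * j + 3)) := by
        gcongr <;> linarith
  have hanti : Antitone f := antitone_nat_of_succ_le fun j => by
    have := hhalf j
    have := hpos j
    linarith
  have htend : Filter.Tendsto (fun n => ∑ i ∈ Finset.range n, (-1) ^ i * f i) Filter.atTop
      (nhds (hermiteSeries x (3 * N + 2) (N + 1))) :=
    (summable_hermiteSeries x (3 * N + 2) (N + 1)).hasSum.tendsto_sum_nat
  have hl := hanti.alternating_series_le_tendsto htend 1
  have hu := hanti.tendsto_le_alternating_series htend 0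
  have hf0 : f 0 = x ^ (3 * N + 2) / (3 * N + 2).factorial := by simp [hf]
  have := hhalf 0
  simp only [mul_one, Finset.sum_range_succ, Finset.range_zero, Finset.sum_empty, pow_zero,
    one_mul, zero_add, pow_one, neg_mul, mul_zero] at hl hu this
  rw [← hf0]
  exact ⟨by linarith, hu⟩

/-! ### Rational approximations near `π / 2` -/

/-- `(2 * r) ^ M * M! * t` is an integer. -/
def HasDenominator (r M : ℕ) (t : ℝ) : Prop := ∃ z : ℤ, (2 * r : ℝ) ^ M * M.factorial * t = z

theorem HasDenominator.succ {r M : ℕ} {t : ℝ} (h : HasDenominator r M t) :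
    HasDenominator r (M + 1) t := by
  obtain ⟨z, hz⟩ := h
  refine ⟨2 * r * (M + 1) * z, ?_⟩
  push_cast
  rw [← hz, Nat.factorial_succ]
  push_cast
  ring

theorem HasDenominator.mono {r M M' : ℕ} {t : ℝ} (h : HasDenominator r M t) (hM : M ≤ M') :
    HasDenominator r M' t := by
  induction M', hM using Nat.le_induction with
  | base => exact h
  | succ n _ ih => exact ih.succ

theorem HasDenominator.sub {r M : ℕ} {s t : ℝ} (hs : HasDenominator r M s)
    (ht : HasDenominator r M t) : HasDenominator r M (s - t) := by
  obtain ⟨y, hy⟩ := hs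
  obtain ⟨z, hz⟩ := ht
  exact ⟨y - z, by rw [mul_sub, hy, hz, Int.cast_sub]⟩

theorem hasDenominator_pow {r : ℕ} {x : ℝ} {y : ℤ} (hx : r * x = y) (i : ℕ) :
    HasDenominator r i (x ^ i / i.factorial) := by
  refine ⟨2 ^ i * y ^ i, ?_⟩
  push_cast
  rw [← hx]
  field_simp
  ring


/-- The case without pole at `w = 0`: `u` and `v` obey the recurrences of the series but start from
1 and 0 in place of `sin x` and `cos x`. A step divides by `2 * c + 2` and multiplies by `x` at most
once, so the denominator grows by `2 * r * (c + 1)`; the error at most doubles. -/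
theorem exists_approx_pair {x δ : ℝ} (h0 : 0 ≤ x) (h2 : x ≤ 2) (hsin : |Real.sin x - 1| ≤ δ)
    (hcos : |Real.cos x| ≤ δ) {r : ℕ} {y : ℤ} (hx : r * x = y) (c : ℕ) :
    ∃ u v : ℝ, HasDenominator r c u ∧ HasDenominator r c v ∧
    |hermiteSeries x (2 * c + 1) (c + 1) - u| ≤ 2 ^ c * δ ∧
      |hermiteSeries x (2 * c) (c + 1) - v| ≤ 2 ^ c * δ := by
  induction c with
  | zero =>
    refine ⟨1, 0, ⟨1, by simp⟩, ⟨0, by simp⟩, ?_, ?_⟩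
    · simpa [hermiteSeries_one_one] using hsin
    · simpa [hermiteSeries_zero_one] using hcos
  | succ c ih =>
    obtain ⟨u, v, ⟨p, hu⟩, ⟨q, hv⟩, hu', hv'⟩ := ih
    have hc : (0 : ℝ) ≤ c := c.cast_nonneg
    have hs := hermiteSeries_add_two x (2 * c + 1) (c + 1)
    have ho := hermiteSeries_odd x c
    have hm := hermiteSeries_mul x c
    rw [show 2 * (c + 1) + 1 = 2 * c + 1 + 2 by ring, show 2 * (c + 1) = 2 * c + 2 by ring,
      show c + 1 + 1 = c + 2 by ring]
    rw [show c + 1 + 1 = c + 2 by ring] at hs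
    have hδ : 0 ≤ 2 ^ c * δ := (abs_nonneg _).trans hu'
    set D := 2 ^ c * δ with hD
    have hmul : ∀ {X : ℝ}, |X| ≤ D → |x * X| ≤ 2 * D := fun {X} hX => by
      rw [abs_mul, abs_of_nonneg h0]
      exact mul_le_mul h2 hX (abs_nonneg _) (by norm_num)
    refine ⟨((2 * c + 1) * u - x * v) / (2 * c + 2), x * u / (2 * c + 2),
      ⟨r * (2 * c + 1) * p - y * q, ?_⟩, ⟨y * p, ?_⟩, ?_, ?_⟩
    · push_cast
      rw [← hu, ← hv, ← hx, Nat.factorial_succ]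
      push_cast
      field_simp
      ring
    · push_cast
      rw [← hu, ← hx, Nat.factorial_succ]
      push_cast
      field_simp
      ring
    · have h3 : (hermiteSeries x (2 * c + 1 + 2) (c + 2) - ((2 * c + 1) * u - x * v) / (2 * c + 2)) *
          (2 * c + 2) = (2 * c + 1) * (hermiteSeries x (2 * c + 1) (c + 1) - u) -
            x * (hermiteSeries x (2 * c) (c + 1) - v) := by
        rw [sub_mul, div_mul_cancel₀ _ (by positivity), hs, sub_mul,
          mul_comm (hermiteSeries x (2 * c + 1) (c + 2)), ho]
        ring
      rw [pow_succ, mul_right_comm, ← hD]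
      refine le_of_mul_le_mul_right ?_ (show (0 : ℝ) < 2 * c + 2 by positivity)
      rw [← abs_of_pos (show (0 : ℝ) < 2 * c + 2 by positivity), ← abs_mul,
        abs_of_pos (show (0 : ℝ) < 2 * c + 2 by positivity), h3]
      have hX : |(2 * c + 1) * (hermiteSeries x (2 * c + 1) (c + 1) - u)| ≤ (2 * c + 1) * D := by
        rw [abs_mul, abs_of_pos (show (0 : ℝ) < 2 * c + 1 by positivity)]
        gcongr
      refine (abs_sub _ _).trans ((add_le_add hX (hmul hv')).trans ?_)
      nlinarith
    · have h3 : (hermiteSeries x (2 * c + 2) (c + 2) - x * u / (2 * c + 2)) * (2 * c + 2) =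
          x * (hermiteSeries x (2 * c + 1) (c + 1) - u) := by
        rw [sub_mul, div_mul_cancel₀ _ (by positivity), mul_comm, hm]
        ring
      rw [pow_succ, mul_right_comm, ← hD]
      refine le_of_mul_le_mul_right ?_ (show (0 : ℝ) < 2 * c + 2 by positivity)
      rw [← abs_of_pos (show (0 : ℝ) < 2 * c + 2 by positivity), ← abs_mul,
        abs_of_pos (show (0 : ℝ) < 2 * c + 2 by positivity), h3]
      refine (hmul hu').trans ?_
      nlinarith

/-- The pole at `w = 0` has order `i - 1`. `hermiteSeries_add_two` lowers either that order or the
power of `w ^ 2 + 1`. The pure powers that split off have exponent at most `i - 2`, whence `i ≤ M +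
2`. -/
theorem exists_approx {x δ : ℝ} (h0 : 0 ≤ x) (h2 : x ≤ 2) (hsin : |Real.sin x - 1| ≤ δ)
    (hcos : |Real.cos x| ≤ δ) {r : ℕ} {y : ℤ} (hx : r * x = y)
    (M c i : ℕ) (hc : c ≤ M) (hi : i ≤ M + 2) : ∃ t : ℝ, HasDenominator r M t ∧
    |hermiteSeries x (i + 2 * c) (c + 1) - t| ≤ 2 ^ (i + c) * δ := by
  have hδ : 0 ≤ δ := (abs_nonneg _).trans hcos
  induction c generalizing i with
  | zero =>
    induction i using Nat.twoStepInduction with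
    | zero =>
      obtain ⟨u, v, -, hv, -, hv'⟩ := exists_approx_pair h0 h2 hsin hcos hx 0
      exact ⟨v, hv.mono hc, by simpa using hv'⟩
    | one =>
      obtain ⟨u, v, hu, -, hu', -⟩ := exists_approx_pair h0 h2 hsin hcos hx 0
      refine ⟨u, hu.mono hc, hu'.trans ?_⟩
      gcongr <;> norm_num
    | more i ih _ =>
      obtain ⟨t, ht, ht'⟩ := ih (by omega)
      refine ⟨x ^ i / i.factorial - t, ((hasDenominator_pow hx i).mono (by omega)).sub ht, ?_⟩
      have hs := hermiteSeries_add_two x i 0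
      rw [hermiteSeries_zero] at hs
      rw [mul_zero, add_zero] at ht' ⊢
      rw [hs, sub_sub_sub_cancel_left, abs_sub_comm]
      refine ht'.trans ?_
      gcongr <;> norm_num
  | succ c ihc =>
    induction i using Nat.twoStepInduction with
    | zero =>
      obtain ⟨u, v, -, hv, -, hv'⟩ := exists_approx_pair h0 h2 hsin hcos hx (c + 1)
      exact ⟨v, hv.mono hc, by simpa using hv'⟩
    | one =>
      obtain ⟨u, v, hu, -, hu', -⟩ := exists_approx_pair h0 h2 hsin hcos hx (c + 1)
      refine ⟨u, hu.mono hc, ?_⟩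
      rw [add_comm 1]
      exact hu'.trans (mul_le_mul_of_nonneg_right
        (pow_le_pow_right₀ (by norm_num) (by omega)) hδ)
    | more i ih _ =>
      obtain ⟨t, ht, ht'⟩ := ih (by omega)
      obtain ⟨s, hs, hs'⟩ := ihc (i + 2) (by omega) hi
      refine ⟨s - t, hs.sub ht, ?_⟩
      rw [show i + 2 + 2 * c = i + 2 * (c + 1) by ring] at hs'
      rw [show i + 2 + 2 * (c + 1) = i + 2 * (c + 1) + 2 by ring, hermiteSeries_add_two,
        sub_sub_sub_comm]
      refine (abs_sub _ _).trans ((add_le_add hs' ht').trans ?_)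
      rw [show i + 2 + c = i + c + 2 by ring, show i + 2 + (c + 1) = i + c + 3 by ring,
        show i + (c + 1) = i + c + 1 by ring, pow_add _ (i + c), pow_add _ (i + c),
        pow_add _ (i + c)]
      have : 0 ≤ 2 ^ (i + c) * δ := by positivity
      linarith

/-! ### Effective irrationality of `π` -/

theorem factorial_three_mul_add_two_ge {r N : ℕ} (h : 16 * r ≤ (N + 1) ^ 2) (hN : 2 ≤ N) :
    2 * (2 ^ (3 * N + 2) * ((2 * r) ^ N * N.factorial)) ≤ (3 * N + 2).factorial := by
  calc 2 * (2 ^ (3 * N + 2) * ((2 * r) ^ N * N.factorial))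
      = N.factorial * ((16 * r) ^ N * 8) := by
        rw [show 3 * N + 2 = N + N + N + 2 by ring, show 16 * r = 2 * 2 * 2 * (2 * r) by ring]
        simp only [mul_pow, pow_add]
        ring
    _ ≤ N.factorial * (((N + 1) ^ 2) ^ N * (N + 1) ^ 2) := by
        gcongr
        nlinarith
    _ = N.factorial * (N + 1) ^ (2 * N + 2) := by rw [← pow_mul, ← pow_add]
    _ ≤ (N + (2 * N + 2)).factorial := Nat.factorial_mul_pow_le_factorial
    _ = _ := by congr 1; ring

/-- An effective irrationality statement for `π / 2`. -/
theorem abs_sub_pi_div_two_ge {x : ℝ} {r N : ℕ} {y : ℤ} (hr : 0 < r) (hx : r * x = y)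
    (h1 : 1 ≤ x) (h2 : x ≤ 2) (h : 16 * r ≤ (N + 1) ^ 2) (hN : 2 ≤ N) :
    1 / (2 * (3 * N + 2).factorial) ≤ 4 ^ (N + 1) * |x - Real.pi / 2| := by
  set δ := |x - Real.pi / 2| with hδ
  have hsin : |Real.sin x - 1| ≤ δ := by
    have := Real.abs_sin_sub_sin_le x (Real.pi / 2)
    rwa [Real.sin_pi_div_two] at this
  have hcos : |Real.cos x| ≤ δ := by
    have := Real.abs_cos_sub_cos_le x (Real.pi / 2)
    rwa [Real.cos_pi_div_two, sub_zero] at this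
  obtain ⟨t, ⟨z, hz⟩, ht⟩ :=
    exists_approx (by linarith) h2 hsin hcos hx N N (N + 2) le_rfl le_rfl
  rw [show N + 2 + 2 * N = 3 * N + 2 by ring, show N + 2 + N = 2 * (N + 1) by ring, pow_mul,
    show (2 : ℝ) ^ 2 = 4 by norm_num] at ht
  obtain ⟨hl, hu⟩ := hermiteSeries_bounds (by linarith) h2 N
  set S := hermiteSeries x (3 * N + 2) (N + 1)
  set u := x ^ (3 * N + 2) / (3 * N + 2).factorial with hu_def
  have hf : (0 : ℝ) < (3 * N + 2).factorial := by positivity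
  have hu1 : 1 / (2 * (3 * N + 2).factorial) ≤ u / 2 := by
    rw [hu_def, div_div, mul_comm (2 : ℝ)]
    gcongr
    exact one_le_pow₀ h1
  refine hu1.trans ?_
  rw [abs_le] at ht
  have hK : (0 : ℝ) < (2 * r) ^ N * N.factorial := by positivity
  set K : ℝ := (2 * r) ^ N * N.factorial with hK_def
  have huK : 2 * (u * K) ≤ 1 := by
    have h3 : (2 * (2 ^ (3 * N + 2) * ((2 * r) ^ N * N.factorial)) : ℝ) ≤
        (3 * N + 2).factorial := by exact_mod_cast factorial_three_mul_add_two_ge h hN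
    have h4 : x ^ (3 * N + 2) ≤ 2 ^ (3 * N + 2) := by gcongr
    rw [hu_def, div_mul_eq_mul_div, mul_div_assoc', div_le_one hf]
    refine le_trans ?_ h3
    gcongr
  have hu0 : 0 < u := by positivity
  -- If `t = 0`, then `S ≥ u / 2` is itself the error. Otherwise `|t| ≥ 1 / K ≥ 2 * u` while `0 < S
  -- ≤ u`, so the error is at least `u`.
  by_cases hz0 : z = 0
  · have ht0 : t = 0 := by
      rw [hz0, Int.cast_zero] at hz
      exact (mul_eq_zero.1 hz).resolve_left hK.ne'
    rw [ht0, sub_zero] at ht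
    linarith
  · have h5 : 1 ≤ |K * t| := by
      rw [hz]
      exact_mod_cast Int.one_le_abs hz0
    have h6 : 2 * u ≤ |t| := by
      rw [abs_mul, abs_of_pos hK] at h5
      refine le_of_mul_le_mul_left ?_ hK
      linarith
    rcases le_abs.1 h6 with h7 | h7 <;> linarith

theorem abs_sub_pi_ge {q N : ℕ} {p : ℤ} (hq : 0 < q) (h1 : 2 ≤ (p / q : ℝ)) (h2 : (p / q : ℝ) ≤ 4)
    (h : 32 * q ≤ (N + 1) ^ 2) (hN : 2 ≤ N) :
    1 / (4 ^ (N + 1) * (3 * N + 2).factorial) ≤ |(p / q : ℝ) - Real.pi| := by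
  have hq' : (0 : ℝ) < q := by exact_mod_cast hq
  have := abs_sub_pi_div_two_ge (x := p / q / 2) (r := 2 * q) (N := N) (y := p) (by omega)
    (by push_cast; field_simp) (by linarith) (by linarith) (by linarith) hN
  rw [← sub_div, abs_div, abs_two, div_le_iff₀ (by positivity)] at this
  rw [div_le_iff₀ (by positivity)]
  linarith

theorem two_mul_four_pow_mul_factorial_le {h N : ℕ} (hh : 4 ≤ h) (hN : N + 1 = 6 * 10 ^ h) :
    2 * (4 ^ (N + 1) * (3 * N + 2).factorial) ≤ 2 ^ 10 ^ (2 * h - 1) := by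
  have h1 : 3 * N + 2 ≤ 2 ^ (5 + 4 * h) := by
    have : 10 ^ h ≤ 2 ^ (4 * h) := by
      rw [pow_mul]
      exact Nat.pow_le_pow_left (by norm_num) h
    rw [pow_add]
    omega
  have h2 : (3 * N + 2).factorial ≤ 2 ^ ((5 + 4 * h) * (18 * 10 ^ h)) := by
    calc (3 * N + 2).factorial ≤ (3 * N + 2) ^ (3 * N + 2) := Nat.factorial_le_pow _
      _ ≤ (2 ^ (5 + 4 * h)) ^ (3 * N + 2) := Nat.pow_le_pow_left h1 _
      _ = 2 ^ ((5 + 4 * h) * (3 * N + 2)) := by rw [← pow_mul]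
      _ ≤ _ := Nat.pow_le_pow_right (by norm_num) (Nat.mul_le_mul_left _ (by omega))
  -- The total exponent is `1 + (12 + 18 * (5 + 4 * h)) * 10 ^ h ≤ (103 + 72 * h) * 10 ^ h`.
  have h3 : 103 + 72 * h ≤ 10 ^ (h - 1) := by
    induction h, hh using Nat.le_induction with
    | base => norm_num
    | succ n hn _ =>
      clear * - hn
      induction n, hn using Nat.le_induction with
      | base => norm_num
      | succ n hn ih =>
        rw [show n + 1 + 1 - 1 = (n + 1 - 1) + 1 by omega, pow_succ]
        omega
  calc 2 * (4 ^ (N + 1) * (3 * N + 2).factorial)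
      ≤ 2 * (4 ^ (6 * 10 ^ h) * 2 ^ ((5 + 4 * h) * (18 * 10 ^ h))) := by rw [← hN]; gcongr
    _ = 2 ^ (1 + (2 * (6 * 10 ^ h) + (5 + 4 * h) * (18 * 10 ^ h))) := by
        rw [show (4 : ℕ) = 2 ^ 2 by norm_num, ← pow_mul, ← pow_add, ← pow_succ']
        ring_nf
    _ ≤ 2 ^ (10 ^ (h - 1) * 10 ^ h) := by
        refine Nat.pow_le_pow_right (by norm_num) ?_
        have : 0 < 10 ^ h := by positivity
        nlinarith
    _ = _ := by rw [← pow_add]; congr 2; omega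

/-- The fractions with denominator `10 ^ n` keep a distance from `π`. -/
theorem two_div_two_pow_le_abs_sub_pi {n : ℕ} {p : ℤ} (hn : 7 ≤ n) (h1 : 2 ≤ (p / 10 ^ n : ℝ))
    (h2 : (p / 10 ^ n : ℝ) ≤ 4) : 2 / 2 ^ 10 ^ n ≤ |(p / 10 ^ n : ℝ) - Real.pi| := by
  -- `h` is `n / 2` rounded up, so `N + 1 = 6 * 10 ^ h` is of order `√(10 ^ n)` and `36 ≥ 32` gives
  -- the size condition; `n ≥ 7` yields `h ≥ 4`.
  obtain ⟨h, hh, hnh, hnh'⟩ : ∃ h, 4 ≤ h ∧ n ≤ 2 * h ∧ 2 * h - 1 ≤ n :=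
    ⟨(n + 1) / 2, by omega, by omega, by omega⟩
  obtain ⟨N, hN⟩ : ∃ N, N + 1 = 6 * 10 ^ h :=
    ⟨6 * 10 ^ h - 1, by have : 0 < 10 ^ h := by positivity
                        omega⟩
  have hpow : 10 ^ n ≤ 10 ^ (2 * h) := Nat.pow_le_pow_right (by norm_num) hnh
  have hsq : 32 * 10 ^ n ≤ (N + 1) ^ 2 := by
    rw [hN, mul_pow, ← pow_mul, mul_comm h 2]
    exact Nat.mul_le_mul (by norm_num) hpow
  have hN2 : 2 ≤ N := by
    have : 0 < 10 ^ h := by positivity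
    omega
  have hq : (p / 10 ^ n : ℝ) = p / ((10 ^ n : ℕ) : ℝ) := by push_cast; rfl
  rw [hq] at h1 h2 ⊢
  refine le_trans ?_ (abs_sub_pi_ge (by positivity) h1 h2 hsq hN2)
  have h3 : 2 * (4 ^ (N + 1) * (3 * N + 2).factorial) ≤ 2 ^ 10 ^ n :=
    (two_mul_four_pow_mul_factorial_le hh hN).trans
      (Nat.pow_le_pow_right (by norm_num) (Nat.pow_le_pow_right (by norm_num) hnh'))
  rw [div_le_div_iff₀ (by positivity) (by positivity), one_mul]
  exact_mod_cast h3

/-! ### Agreement of the digits of `π_E` and `π` -/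

theorem floor_eq_floor {n E k : ℕ} (hE : Even E) (h2 : 2 ≤ E) (hEk : E + 4 = 4 * 2 ^ k)
    (hk : 10 ^ n ≤ k) : ⌊10 ^ n * piApprox E⌋₊ = ⌊10 ^ n * Real.pi⌋₊ := by
  have hlt := pi_lt_piApprox hE h2
  have hsub := piApprox_sub_pi_lt hE h2
  have hpi3 := Real.pi_gt_three
  have hpi4 := Real.pi_lt_four
  have hk1 : 1 ≤ k := le_trans (Nat.one_le_pow _ _ (by norm_num)) hk
  have hE' : 2 * 2 ^ k ≤ E := by
    have : 2 ^ 1 ≤ 2 ^ k := Nat.pow_le_pow_right (by norm_num) hk1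
    omega
  have hER : (2 * 2 ^ k : ℝ) ≤ E := by exact_mod_cast hE'
  have hsub' : piApprox E - Real.pi < 2 / 2 ^ k := by
    refine hsub.trans_le ?_
    have : (0 : ℝ) < 2 ^ k := by positivity
    rw [div_le_div_iff₀ (by linarith) this]
    nlinarith
  have hle : ∀ m : ℕ, m ≤ k → piApprox E < Real.pi + 2 / 2 ^ m := by
    intro m hm
    have : (2 / 2 ^ k : ℝ) ≤ 2 / 2 ^ m := by
      gcongr
      norm_num
    linarith
  rcases Nat.lt_or_ge n 7 with hn | hn
  · have hlo := Real.pi_gt_d20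
    have hhi := Real.pi_lt_d20
    have main : ∀ m : ℕ, (m : ℝ) ≤ 10 ^ n * Real.pi → 10 ^ n * piApprox E < m + 1 →
        ⌊10 ^ n * piApprox E⌋₊ = ⌊10 ^ n * Real.pi⌋₊ := by
      intro m h3 h4
      have h5 : (10 : ℝ) ^ n * Real.pi < 10 ^ n * piApprox E :=
        mul_lt_mul_of_pos_left hlt (by positivity)
      rw [(Nat.floor_eq_iff (by positivity)).2 ⟨h3, h5.trans h4⟩,
        Nat.floor_eq_iff (h3.trans h5.le |>.trans' m.cast_nonneg)]
      exact ⟨h3.trans h5.le, h4⟩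
    rcases Nat.lt_or_ge n 2 with hn2 | hn2
    · interval_cases n
      · have hE4 : (4 : ℝ) ≤ E := by
          have : 2 ^ 1 ≤ 2 ^ k := Nat.pow_le_pow_right (by norm_num) hk1
          have : 4 ≤ E := by omega
          exact_mod_cast this
        have h6 : Real.pi / E ≤ Real.pi / 4 := by gcongr
        refine main 3 ?_ ?_ <;> norm_num <;> linarith
      · have := hle 10 (by omega)
        refine main 31 ?_ ?_ <;> norm_num at this ⊢ <;> linarith
    -- For `2 ≤ n` already `k ≥ 100`, so the error is far smaller than the known decimals need.
    · have := hle 100 (le_trans (by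
        calc 100 = 10 ^ 2 := by norm_num
          _ ≤ 10 ^ n := Nat.pow_le_pow_right (by norm_num) hn2) hk)
      interval_cases n
      · refine main 314 ?_ ?_ <;> norm_num at this ⊢ <;> linarith
      · refine main 3141 ?_ ?_ <;> norm_num at this ⊢ <;> linarith
      · refine main 31415 ?_ ?_ <;> norm_num at this ⊢ <;> linarith
      · refine main 314159 ?_ ?_ <;> norm_num at this ⊢ <;> linarith
      · refine main 3141592 ?_ ?_ <;> norm_num at this ⊢ <;> linarith
  · refine le_antisymm ?_ (Nat.floor_mono (by gcongr))
    -- If the floors differ, `p / 10 ^ n` lies in `(π, π_E]`, too close to `π`.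
    by_contra! hcon
    set p := ⌊10 ^ n * piApprox E⌋₊ with hp
    have h10 : (0 : ℝ) < 10 ^ n := by positivity
    have h3 : 10 ^ n * Real.pi < p := (Nat.floor_lt (by positivity)).1 hcon
    have h4 : (p : ℝ) ≤ 10 ^ n * piApprox E :=
      Nat.floor_le (mul_nonneg h10.le (Real.pi_pos.trans hlt).le)
    have h5 : Real.pi < p / 10 ^ n := by rwa [lt_div_iff₀ h10, mul_comm]
    have h6 : (p / 10 ^ n : ℝ) ≤ piApprox E := by rwa [div_le_iff₀ h10, mul_comm]
    have h7 := hle (10 ^ n) hk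
    have h8 : (2 / 2 ^ 10 ^ n : ℝ) ≤ 2 / 2 ^ 2 := by
      gcongr
      · norm_num
      · calc 2 ≤ 10 ^ 1 := by norm_num
          _ ≤ 10 ^ n := Nat.pow_le_pow_right (by norm_num) (by omega)
    have hpi := Real.pi_lt_d2
    have h9 := two_div_two_pow_le_abs_sub_pi (p := p) hn
      (by rw [Int.cast_natCast]; linarith) (by rw [Int.cast_natCast]; norm_num at h8 hpi; linarith)
    rw [Int.cast_natCast, abs_of_pos (sub_pos.2 h5)] at h9
    linarith

theorem mainTheorem3 :
    (∀ n : ℕ, FractranHaltsAt piGame (2 ^ n * 89) (2 ^ decimalDigit Real.pi n)) ∧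
    (∀ E : ℕ, Even E → 2 ≤ E →
      piApprox E * ((E : ℝ) / ((E : ℝ) + 1)) < Real.pi ∧ Real.pi < piApprox E ∧
        |Real.pi - piApprox E| < Real.pi / (E : ℝ)) ∧
    (∀ E : ℕ, Even E → 4 ≤ E → ∀ n : ℕ, ¬ ∃ z : ℤ, (10 : ℝ) ^ n * piApprox E = (z : ℝ)) := by
  refine ⟨fun n => ?_, fun E hE h2 => ⟨piApprox_mul_lt_pi hE h2, pi_lt_piApprox hE h2,
    abs_pi_sub_piApprox_lt hE h2⟩, fun E hE h4 n => not_exists_int_piApprox hE h4 n⟩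
  obtain ⟨E, k, h1, h2, h3⟩ := fractranHaltsAt_piGame n
  have hk : 2 ^ 1 ≤ 2 ^ k :=
    Nat.pow_le_pow_right (by norm_num) (le_trans (Nat.one_le_pow _ _ (by norm_num)) h2)
  have hE : Even E := by
    rw [Nat.even_iff]
    omega
  have h4 : 10 ^ n * wallisNum E / wallisDen E = ⌊10 ^ n * Real.pi⌋₊ := by
    rw [← floor_eq_floor hE (by omega) h1 h2, piApprox, mul_div_assoc',
      ← Nat.floor_div_eq_div (K := ℝ)]
    push_cast
    rfl
  rwa [h4] at h3
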